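/- Let $P$ be a poset on $[n]=\{1,\dots,n\}$, with order $\le_P$. A set partition $\pi$ of $[n]$ is *$P$-transverse* if its blocks are antichains of $P$ and the preposet $P/\pi$ on its blocks (the transitive closure of: $B\le C$ if $p\le_P q$ for some $p\in B$, $q\in C$) is a poset. A permutation $\tau\in\mathfrak S_n$ is *$P$-transverse* if the partition of $[n]$ into its cycles (fixed points included) is $P$-transverse; $\mathrm{cyc}(\tau)$ is the number of cycles. A *linear extension* of $P$ is a permutation $\sigma=[\sigma_1,\dots,\sigma_n]$ in which $i$ stands before $j$ whenever $i<_P j$; $\mathcal L(P)$ is the set of these. *Standard form of a $P$-transverse $\tau$.* With $\pi$ the cycle partition of $\tau$, the blocks of level $k\ge 1$ are the minimal blocks of $P/\pi$ after all blocks of level less than $k$ are removed; the level of an element is that of its block. An element $x$ is *essential* if it has level $1$, or if $x>_P y$ for some $y$ whose level is one less than that of $x$. A standard form of $\tau$ is a listing of its cycles, each written $(x,\tau(x),\tau^2(x),\dots)$ with $x$ the largest (as an integer) essential element of the cycle, by increasing level and, within a level, by increasing first element. *$P$-left-to-right maxima of $\sigma\in\mathcal L(P)$.* Cut $\sigma$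 into consecutive segments, the levels $1,2,\dots$ of $\sigma$, each being the longest initial segment of what is left of $\sigma$ that is an antichain of $P$. Essential elements of $\sigma$ are defined from these levels as above. An element is a $P$-left-to-right maximum if it is essential and is a left-to-right maximum, in the usual sense, of the subsequence of essential elements of its level; $\mathsf{LRmax}_P(\sigma)$ is the number of these. *Poincaré polynomial.* Let $\mathcal K_P=\{x\in\mathbb R^n: x_i<x_j \text{ whenever } i<_P j\}$, let $L$ be the poset of all intersections of hyperplanes $\{x_i=x_j\}$, $i<j$ (including the empty intersection $V=\mathbb R^n$), ordered by reverse inclusion, and let $\mu$ be its Möbius function. Put $\mathsf{Poin}(P,t)=\sum_{X\in L,\ X\cap\mathcal K_P\ne\varnothing}|\mu(V,X)|\,t^{\operatorname{codim}X}$. **Theorem.** Every $P$-transverse permutation $\tau$ has exactly one standard form. Erasing its parentheses gives the one-line notation of a linear extension $\Phi(\tau)$ of $P$; the map $\Phi$ is a bijection from the $P$-transverse permutations to $\mathcal L(P)$, and $\mathrm{cyc}(\tau)=\mathsf{LRmax}_P(\Phi(\tau))$ for all $\tau$. Consequently $$\mathsf{Poin}(P,t)=\sum_{\sigma\in\mathcal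 L(P)}t^{\,n-\mathsf{LRmax}_P(\sigma)}.$$ If $P$ is an antichain, then all permutations in $\mathfrak S_n$ are $P$-transverse and are linear extensions of $P$, $\mathsf{LRmax}_P$ is the usual number of left-to-right maxima, and $\Phi$ is the fundamental bijection (write each cycle with its largest element first, list the cycles by increasing largest element, erase the parentheses). -/

import Mathlib

namespace PosetCone

noncomputable section

open Polynomial

/-! ### Central hyperplane arrangements, intersection posets and Poincaré polynomials of cones -/

section Arrangement

variable {V : Type*} [AddCommGroup V] [Module ℝ V]

open scoped Classical in
/-- All intersections of subfamilies of a finite family `A` of linear hyperplanes; the empty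
subfamily gives `V`. They are ordered by reverse inclusion, hence the order dual. -/
def intersections (A : Finset (Submodule ℝ V)) : Finset (Submodule ℝ V)ᵒᵈ :=
  A.powerset.image fun S => OrderDual.toDual (S.inf id)

/-- The intersection poset of `A`, ordered by reverse inclusion. -/
abbrev IntersectionPoset (A : Finset (Submodule ℝ V)) : Type _ :=
  {X : (Submodule ℝ V)ᵒᵈ // X ∈ intersections A}

/-- The subspace of `V` underlying an element of the intersection poset. -/
def IntersectionPoset.subspace {A : Finset (Submodule ℝ V)} (X : IntersectionPoset A) :
    Submodule ℝ V :=
  OrderDual.ofDual X.1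

/-- The minimal element of the intersection poset: the whole space `V`. -/
def IntersectionPoset.whole (A : Finset (Submodule ℝ V)) : IntersectionPoset A :=
  ⟨OrderDual.toDual ⊤, by
    classical
    exact Finset.mem_image.2 ⟨∅, Finset.empty_mem_powerset A, by simp⟩⟩

open scoped Classical in
instance (A : Finset (Submodule ℝ V)) : LocallyFiniteOrder (IntersectionPoset A) :=
  Fintype.toLocallyFiniteOrder

open scoped Classical in
/-- The Möbius function value `μ(V, X)` in the intersection poset. -/
def moebius (A : Finset (Submodule ℝ V)) (X : IntersectionPoset A) : ℤ :=
  IncidenceAlgebra.mu ℤ (IntersectionPoset.whole A) X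

open scoped Classical in
/-- The signless Whitney number `c_k(K)`: the sum of `|μ(V, X)|` over the intersections `X` of
codimension `k` that meet the cone `K`. -/
def whitney (A : Finset (Submodule ℝ V)) (K : Set V) (k : ℕ) : ℕ :=
  ∑ X : IntersectionPoset A with
    (((X.subspace : Set V) ∩ K).Nonempty ∧ Module.finrank ℝ (V ⧸ X.subspace) = k),
    (moebius A X).natAbs

/-- The Poincaré polynomial `∑ c_k(K) t^k`, `0 ≤ k ≤ dim V`, of a cone `K` of `A`. -/
def poincare (A : Finset (Submodule ℝ V)) (K : Set V) : ℕ[X] :=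
  ∑ k ∈ Finset.range (Module.finrank ℝ V + 1), C (whitney A K k) * X ^ k

end Arrangement

section Poset

variable {n : ℕ}

/-- The hyperplane `x_i = x_j` of `ℝⁿ`. -/
def braidHyperplane (i j : Fin n) : Submodule ℝ (Fin n → ℝ) where
  carrier := {x | x i = x j}
  add_mem' {x y} hx hy := by
    simp only [Set.mem_ofPred_eq, Pi.add_apply] at *
    rw [hx, hy]
  zero_mem' := rfl
  smul_mem' c x hx := by
    simp only [Set.mem_ofPred_eq, Pi.smul_apply] at *
    rw [hx]

open scoped Classical in
/-- The braid arrangement in `ℝⁿ`. -/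
def braidArrangement (n : ℕ) : Finset (Submodule ℝ (Fin n → ℝ)) :=
  (Finset.univ.filter fun p : Fin n × Fin n => p.1 < p.2).image
    fun p => braidHyperplane p.1 p.2

/-- The strict relation `i <_P j` of a poset on `[n]`. A poset on `[n]` is given by its relation
`P i j`, read `i ≤_P j`; the signs `<` and `≤` on `Fin n` always mean the order of the integers. -/
def StrictRel (P : Fin n → Fin n → Prop) (i j : Fin n) : Prop :=
  P i j ∧ i ≠ j

/-- The cone of the braid arrangement attached to a poset on `[n]`. -/
def posetCone (P : Fin n → Fin n → Prop) : Set (Fin n → ℝ) :=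
  {x | ∀ i j, StrictRel P i j → x i < x j}

/-- The Poincaré polynomial `Poin(P, t)`. -/
def Poin (P : Fin n → Fin n → Prop) : ℕ[X] :=
  poincare (braidArrangement n) (posetCone P)

/-! ### Transverse permutations and linear extensions -/

/-- The preposet `P/π` on the blocks of a set partition `π`. -/
def quotLE (P : Fin n → Fin n → Prop) (π : Setoid (Fin n)) : Quotient π → Quotient π → Prop :=
  Relation.TransGen fun B C => ∃ p q : Fin n, Quotient.mk π p = B ∧ Quotient.mk π q = C ∧ P p q

/-- `π` is `P`-transverse: its blocks are antichains of `P`, and `P/π` is a poset. -/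
def IsTransverse (P : Fin n → Fin n → Prop) (π : Setoid (Fin n)) : Prop :=
  (∀ p q, π p q → ¬ StrictRel P p q) ∧ ∀ B C, quotLE P π B C → quotLE P π C B → B = C

/-- The set partition of `[n]` into the cycles of `τ`, fixed points included. -/
abbrev cyclePartition (τ : Equiv.Perm (Fin n)) : Setoid (Fin n) :=
  Equiv.Perm.SameCycle.setoid τ

/-- The number of cycles of `τ`, fixed points included. -/
def cyc (τ : Equiv.Perm (Fin n)) : ℕ :=
  Nat.card (Quotient (cyclePartition τ))

open scoped Classical in
/-- The `P`-transverse permutations. -/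
def transversePerms (P : Fin n → Fin n → Prop) : Finset (Equiv.Perm (Fin n)) :=
  Finset.univ.filter fun τ => IsTransverse P (cyclePartition τ)

open scoped Classical in
/-- The linear extensions of `P`, as permutations in one-line notation `[σ 0, …, σ (n - 1)]`. -/
def linearExtensions (P : Fin n → Fin n → Prop) : Finset (Equiv.Perm (Fin n)) :=
  Finset.univ.filter fun σ => ∀ i j, StrictRel P i j → σ.symm i < σ.symm j

/-- Relative to a partition of `[n]` into levels `1, 2, …`, an element is essential if it has level
`1`, or if it is above an element of the preceding level. -/
def Essential (P : Fin n → Fin n → Prop) (level : Fin n → ℕ) (x : Fin n) : Prop :=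
  level x = 1 ∨ ∃ y, level y + 1 = level x ∧ StrictRel P y x

/-! ### Levels and the standard form of a transverse permutation -/

/-- The minimal blocks of `P/π` within a set `S` of blocks. -/
def minimalBlocks (P : Fin n → Fin n → Prop) (π : Setoid (Fin n)) (S : Set (Quotient π)) :
    Set (Quotient π) :=
  {B | B ∈ S ∧ ∀ C ∈ S, quotLE P π C B → C = B}

/-- The blocks that remain when all blocks of level at most `k` are removed. -/
def remainingBlocks (P : Fin n → Fin n → Prop) (π : Setoid (Fin n)) : ℕ → Set (Quotient π)
  | 0 => Set.univ
  | k + 1 => remainingBlocks P π k \ minimalBlocks P π (remainingBlocks P π k)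

/-- The level of a block: the `k ≥ 1` for which it is minimal among the blocks that remain when all
blocks of level less than `k` are removed. -/
def blockLevel (P : Fin n → Fin n → Prop) (π : Setoid (Fin n)) (B : Quotient π) : ℕ :=
  sInf {k | ∃ m, k = m + 1 ∧ B ∈ minimalBlocks P π (remainingBlocks P π m)}

/-- The level of an element with respect to the cycle partition of `τ`. -/
def permLevel (P : Fin n → Fin n → Prop) (τ : Equiv.Perm (Fin n)) (x : Fin n) : ℕ :=
  blockLevel P (cyclePartition τ) (Quotient.mk _ x)

/-- The cycle of `τ` through `x`, written as `(x, τ x, τ² x, …)`. -/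
def cycleWord (τ : Equiv.Perm (Fin n)) (x : Fin n) : List (Fin n) :=
  List.iterate τ x (Function.minimalPeriod τ x)

/-- `xs` is the list of first elements of the cycles in the standard form of `τ`. -/
structure IsStandardForm (P : Fin n → Fin n → Prop) (τ : Equiv.Perm (Fin n))
    (xs : List (Fin n)) : Prop where
  /-- Every cycle is listed, through exactly one first element. -/
  cycles : ∀ y, ∃! x, x ∈ xs ∧ τ.SameCycle x y
  /-- The first element of a cycle is essential, and the largest essential element of the cycle. -/
  essential : ∀ x ∈ xs, Essential P (permLevel P τ) x
  maximal : ∀ x ∈ xs, ∀ y, τ.SameCycle x y → Essential P (permLevel P τ) y → y ≤ x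
  /-- The cycles are listed by increasing level and, within a level, by increasing first
  element. -/
  sorted : xs.Pairwise fun x y =>
    permLevel P τ x < permLevel P τ y ∨ (permLevel P τ x = permLevel P τ y ∧ x < y)

/-- The word obtained by listing the cycles with first elements `xs` and erasing parentheses. -/
def eraseParentheses (τ : Equiv.Perm (Fin n)) (xs : List (Fin n)) : List (Fin n) :=
  (xs.map (cycleWord τ)).flatten

/-! ### Levels and left-to-right maxima of a linear extension -/

/-- The number of entries of `σ` of level at most `k`: having cut off the first `t` entries, one
cuts off the longest initial segment of the rest that is an antichain of `P`. -/
def levelEnd (P : Fin n → Fin n → Prop) (σ : Equiv.Perm (Fin n)) : ℕ → ℕ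
  | 0 => 0
  | k + 1 => sSup {t | t ≤ n ∧
      IsAntichain P {x : Fin n | levelEnd P σ k ≤ (σ.symm x : ℕ) ∧ (σ.symm x : ℕ) < t}}

/-- The level of the element `x` in `σ`. -/
def wordLevel (P : Fin n → Fin n → Prop) (σ : Equiv.Perm (Fin n)) (x : Fin n) : ℕ :=
  sInf {k | (σ.symm x : ℕ) < levelEnd P σ k}

/-- `x` is essential in `σ`, and it is a left-to-right maximum of the subsequence of the essential
elements of `σ` that have the same level as `x`. -/
def IsPLRMax (P : Fin n → Fin n → Prop) (σ : Equiv.Perm (Fin n)) (x : Fin n) : Prop :=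
  Essential P (wordLevel P σ) x ∧
    ∀ y, Essential P (wordLevel P σ) y → wordLevel P σ y = wordLevel P σ x →
      σ.symm y ≤ σ.symm x → y ≤ x

/-- The number of `P`-left-to-right maxima of `σ`. -/
def PLRmax (P : Fin n → Fin n → Prop) (σ : Equiv.Perm (Fin n)) : ℕ :=
  Set.ncard {x | IsPLRMax P σ x}

/-! ### The fundamental bijection -/

/-- The number of left-to-right maxima of `σ` in the usual sense. -/
def LRmax (σ : Equiv.Perm (Fin n)) : ℕ :=
  Set.ncard {x : Fin n | ∀ y, σ.symm y ≤ σ.symm x → y ≤ x}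

open scoped Classical in
/-- The one-line notation of the image of `τ` under the fundamental bijection: write each cycle with
its largest element first, list the cycles by increasing largest element, erase parentheses. -/
def fundamentalWord (τ : Equiv.Perm (Fin n)) : List (Fin n) :=
  eraseParentheses τ
    ((Finset.univ.filter fun x : Fin n => ∀ y, τ.SameCycle x y → y ≤ x).sort (· ≤ ·))

end Poset

end

end PosetCone

/-! For a fixed injective weight `w`, the fundamental bijection of the symmetric group still works
when elements are compared by `w`: each cycle starts with its heaviest element and the heads
increase. The map Φ is this construction for the lexicographic weight (level, essential or not,
integer). Within a block of constant level that has an essential element, the heaviest element is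
the largest essential one, so standard forms are exactly the head lists
(`IsBlockLevel.isStandardForm_iff`), and the `P`-left-to-right maxima are exactly the weight records
(`IsWordLevel.isPLRMax_iff`).

The difficulty is that the weight depends on the permutation through its levels. Both recursive
definitions of levels are therefore replaced by characterizations: `permLevel` is the only function
satisfying `IsBlockLevel`, and `wordLevel` the only one satisfying `IsWordLevel`. If σ is the cycle
form of τ for the weight built from ℓ, then ℓ is a block level of τ if and only if it is a word
level of σ (`IsBlockLevel.isWordLevel`, `IsWordLevel.isBlockLevel`). So τ and σ determine the same
weight, and bijectivity reduces to that for a fixed weight.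

For the Poincaré polynomial, Möbius inversion gives μ(V, X) as the sum of the signs of the
permutations with fixed space X. These have the same cycle partition, hence the same sign, so |μ(V,
X)| counts them. The fixed space of τ has codimension `n - cyc τ` and meets the cone exactly when τ
is transverse. -/

namespace PosetCone

/-! ### Intrinsic characterizations of the levels of partitions and of words. -/

section Levels

variable {n : ℕ} {P : Fin n → Fin n → Prop} {ℓ : Fin n → ℕ}

/-- A positive function that is strictly increasing along the strict relation of `P`. -/
structure IsLevelFunction (P : Fin n → Fin n → Prop) (ℓ : Fin n → ℕ) : Prop where
  pos : ∀ x, 1 ≤ ℓ x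
  strict : ∀ p q, StrictRel P p q → ℓ p < ℓ q

/-- A level function that is constant on the blocks of `π`, each of which has an essential
element. -/
structure IsBlockLevel (P : Fin n → Fin n → Prop) (π : Setoid (Fin n)) (ℓ : Fin n → ℕ) : Prop
    extends IsLevelFunction P ℓ where
  const : ∀ p q, π p q → ℓ p = ℓ q
  exists_essential : ∀ x, ∃ y, π x y ∧ Essential P ℓ y

/-- A level function that is weakly increasing along the word `σ`, the first element of each level
being essential. -/
structure IsWordLevel (P : Fin n → Fin n → Prop) (σ : Equiv.Perm (Fin n)) (ℓ : Fin n → ℕ) : Prop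
    extends IsLevelFunction P ℓ where
  mono : ∀ x y, σ.symm x ≤ σ.symm y → ℓ x ≤ ℓ y
  first : ∀ x, (∀ y, σ.symm y < σ.symm x → ℓ y < ℓ x) → Essential P ℓ x

/-! ### Levels of set partitions -/

/-- Each generating step of `P/π` either stays in a block or strictly raises `f`. The codomain is
general because `f` will be a level function or a real point of the cone. -/
lemma eq_or_lt_of_quotLE {π : Setoid (Fin n)} {α : Type*} [LinearOrder α] {f : Fin n → α}
    (hf : ∀ p q, StrictRel P p q → f p < f q) (hc : ∀ p q, π p q → f p = f q)
    {B C : Quotient π} (h : quotLE P π B C) :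
    B = C ∨ Quotient.lift f hc B < Quotient.lift f hc C := by
  have step : ∀ B C : Quotient π,
      (∃ p q : Fin n, Quotient.mk π p = B ∧ Quotient.mk π q = C ∧ P p q) →
      B = C ∨ Quotient.lift f hc B < Quotient.lift f hc C := by
    rintro _ _ ⟨p, q, rfl, rfl, hpq⟩
    by_cases e : p = q
    · left; rw [e]
    · right; exact hf p q ⟨hpq, e⟩
  induction h with
  | single h => exact step _ _ h
  | tail _ h ih =>
    rcases ih with rfl | ih
    · exact step _ _ h
    · rcases step _ _ h with rfl | h'
      · exact Or.inr ih
      · exact Or.inr (ih.trans h')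

lemma isTransverse_of_strictMono {π : Setoid (Fin n)} {α : Type*} [LinearOrder α] {f : Fin n → α}
    (hf : ∀ p q, StrictRel P p q → f p < f q) (hc : ∀ p q, π p q → f p = f q) :
    IsTransverse P π := by
  refine ⟨fun p q h hs => (hf p q hs).ne (hc p q h), fun B C h h' => ?_⟩
  rcases eq_or_lt_of_quotLE hf hc h with e | h1
  · exact e
  · rcases eq_or_lt_of_quotLE hf hc h' with e | h2
    · exact e.symm
    · exact absurd h1 h2.asymm

lemma IsBlockLevel.isTransverse {π : Setoid (Fin n)} (h : IsBlockLevel P π ℓ) :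
    IsTransverse P π :=
  isTransverse_of_strictMono h.strict h.const

/-- A block of level above `k + 1` has an essential element, which lies over an element of the
preceding level; the block of the latter is still present, so the former is not minimal. Conversely,
a block strictly below one of level `k + 1` has level at most `k`. -/
lemma IsBlockLevel.minimalBlocks_eq {π : Setoid (Fin n)} (h : IsBlockLevel P π ℓ) (k : ℕ) :
    minimalBlocks P π {B | k < Quotient.lift ℓ h.const B} =
      {B | Quotient.lift ℓ h.const B = k + 1} := by
  ext B
  constructor
  · rintro ⟨hB, hmin⟩
    by_contra hne
    induction B using Quotient.inductionOn with | _ b => ?_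
    obtain ⟨x, hbx, hx⟩ := h.exists_essential b
    have e := h.const b x hbx
    simp only [Set.mem_ofPred_eq, Quotient.lift_mk] at hB hne
    rcases hx with hx | ⟨y, hy, hyx⟩
    · omega
    · have := hmin (Quotient.mk π y) (by simp only [Set.mem_ofPred_eq, Quotient.lift_mk]; omega)
        (Relation.TransGen.single ⟨y, x, rfl, Quotient.sound (π.symm hbx), hyx.1⟩)
      have := h.const _ _ (Quotient.exact this)
      omega
  · intro hB
    simp only [Set.mem_ofPred_eq] at hB
    refine ⟨by simp only [Set.mem_ofPred_eq]; omega, fun C hC hCB => ?_⟩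
    simp only [Set.mem_ofPred_eq] at hC
    rcases eq_or_lt_of_quotLE h.strict h.const hCB with e | hlt
    · exact e
    · omega

lemma IsBlockLevel.remainingBlocks_eq {π : Setoid (Fin n)} (h : IsBlockLevel P π ℓ) (k : ℕ) :
    remainingBlocks P π k = {B | k < Quotient.lift ℓ h.const B} := by
  induction k with
  | zero =>
    refine Set.ext fun B => ?_
    induction B using Quotient.inductionOn with | _ b => ?_
    simpa [remainingBlocks] using Nat.lt_of_succ_le (h.pos b)
  | succ k ih =>
    rw [remainingBlocks, ih, h.minimalBlocks_eq]
    ext B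
    simp only [Set.mem_sdiff, Set.mem_ofPred_eq]
    omega

lemma IsBlockLevel.blockLevel_eq {π : Setoid (Fin n)} (h : IsBlockLevel P π ℓ) (x : Fin n) :
    blockLevel P π (Quotient.mk π x) = ℓ x := by
  have hx := h.pos x
  have : {k | ∃ m, k = m + 1 ∧ Quotient.mk π x ∈ minimalBlocks P π (remainingBlocks P π m)} =
      {ℓ x} := by
    ext k
    simp only [h.remainingBlocks_eq, h.minimalBlocks_eq, Set.mem_ofPred_eq, Quotient.lift_mk,
      Set.mem_singleton_iff]
    exact ⟨fun ⟨m, h1, h2⟩ => by omega, fun h1 => ⟨k - 1, by omega, by omega⟩⟩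
  rw [blockLevel, this, csInf_singleton]

/-- The level of a block is its height: one more than the largest level of a block below it. A block
attaining this maximum provides the essential element. -/
lemma IsTransverse.exists_isBlockLevel {π : Setoid (Fin n)} (h : IsTransverse P π) :
    ∃ ℓ, IsBlockLevel P π ℓ := by
  classical
  let R : Quotient π → Quotient π → Prop := fun B C =>
    ∃ p q : Fin n, Quotient.mk π p = B ∧ Quotient.mk π q = C ∧ StrictRel P p q
  have hR : WellFounded R := by
    let S : Quotient π → Quotient π → Prop := fun B C => B ≠ C ∧ quotLE P π B C
    have : IsTrans _ S := ⟨fun B C D h1 h2 =>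
      ⟨fun e => h1.1 (h.2 _ _ h1.2 (e ▸ h2.2)), h1.2.trans h2.2⟩⟩
    have : Std.Irrefl S := ⟨fun B h1 => h1.1 rfl⟩
    refine Subrelation.wf (r := S) ?_ (Finite.wellFounded_of_trans_of_irrefl S)
    rintro _ _ ⟨p, q, rfl, rfl, hpq⟩
    exact ⟨fun e => h.1 p q (Quotient.exact e) hpq,
      Relation.TransGen.single ⟨p, q, rfl, rfl, hpq.1⟩⟩
  let F : (B : Quotient π) → ((C : Quotient π) → R C B → ℕ) → ℕ := fun B ih =>
    1 + (Finset.univ : Finset (Quotient π)).sup fun C => if hC : R C B then ih C hC else 0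
  let lev : Quotient π → ℕ := hR.fix F
  have lev_eq : ∀ B, lev B = 1 + (Finset.univ : Finset (Quotient π)).sup
      fun C => if R C B then lev C else 0 := fun B => by
    change hR.fix F B = _
    rw [hR.fix_eq]
    simp only [F, dite_eq_ite]
    rfl
  have lev_lt : ∀ B C, R B C → lev B < lev C := fun B C hBC => by
    have := Finset.le_sup (f := fun D => if R D C then lev D else 0) (Finset.mem_univ B)
    simp only [if_pos hBC] at this
    rw [lev_eq C]
    omega
  refine ⟨fun x => lev (Quotient.mk π x), ⟨fun x => ?_, fun p q hpq => ?_⟩,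
    fun p q hpq => ?_, fun x => ?_⟩
  · rw [lev_eq]; omega
  · exact lev_lt _ _ ⟨p, q, rfl, rfl, hpq⟩
  · rw [Quotient.sound hpq]
  · obtain ⟨C, -, hC⟩ := Finset.exists_mem_eq_sup (Finset.univ : Finset (Quotient π))
      ⟨Quotient.mk π x, Finset.mem_univ _⟩ (fun C => if R C (Quotient.mk π x) then lev C else 0)
    have hx := lev_eq (Quotient.mk π x)
    rw [hC] at hx
    -- If the supremum is attained at a block that is not below, its value is the default 0 and the
    -- level is 1.
    split_ifs at hx with hR
    · obtain ⟨p, q, rfl, hq, hpq⟩ := hR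
      refine ⟨q, π.symm (Quotient.exact hq), Or.inr ⟨p, ?_, hpq⟩⟩
      change lev _ + 1 = lev _
      rw [hq, hx]; omega
    · exact ⟨x, π.refl x, Or.inl hx⟩

lemma permLevel_eq {τ : Equiv.Perm (Fin n)} (h : IsBlockLevel P (cyclePartition τ) ℓ) :
    permLevel P τ = ℓ :=
  funext fun x => h.blockLevel_eq x

lemma isBlockLevel_permLevel {τ : Equiv.Perm (Fin n)} (h : IsTransverse P (cyclePartition τ)) :
    IsBlockLevel P (cyclePartition τ) (permLevel P τ) := by
  obtain ⟨ℓ, hℓ⟩ := h.exists_isBlockLevel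
  rwa [permLevel_eq hℓ]

/-! ### Levels of words -/

section Word

variable {σ : Equiv.Perm (Fin n)}

lemma levelEnd_le (k : ℕ) : levelEnd P σ k ≤ n := by
  cases k with
  | zero => exact Nat.zero_le n
  | succ k => exact csSup_le' fun t ht => ht.1

lemma bddAbove_antichainEnds (a : ℕ) : BddAbove {t | t ≤ n ∧
    IsAntichain P {x : Fin n | a ≤ (σ.symm x : ℕ) ∧ (σ.symm x : ℕ) < t}} :=
  ⟨n, fun _ ht => ht.1⟩

lemma isAntichain_level (k : ℕ) : IsAntichain P {x : Fin n | levelEnd P σ k ≤ (σ.symm x : ℕ) ∧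
    (σ.symm x : ℕ) < levelEnd P σ (k + 1)} := by
  refine (Nat.sSup_mem (s := {t | t ≤ n ∧ IsAntichain P {x : Fin n | levelEnd P σ k ≤
    (σ.symm x : ℕ) ∧ (σ.symm x : ℕ) < t}}) ⟨0, Nat.zero_le n, ?_⟩ (bddAbove_antichainEnds _)).2
  intro x hx
  exact absurd hx.2 (Nat.not_lt_zero _)

/-- A single entry is an antichain, so every cut advances until the word is exhausted. This keeps
the infimum in `wordLevel` from being taken over an empty set. -/
lemma min_le_levelEnd_succ (k : ℕ) : min n (levelEnd P σ k + 1) ≤ levelEnd P σ (k + 1) := by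
  refine le_csSup (bddAbove_antichainEnds _) ⟨min_le_left _ _, ?_⟩
  intro x hx y hy hne
  refine absurd (σ.symm.injective (Fin.ext ?_)) hne
  have h1 := hx.2; have h2 := hy.2; have h3 := hx.1; have h4 := hy.1
  omega

lemma levelEnd_mono : Monotone (levelEnd P σ) := by
  refine monotone_nat_of_le_succ fun k => ?_
  have h1 := min_le_levelEnd_succ (P := P) (σ := σ) k
  have h2 := levelEnd_le (P := P) (σ := σ) k
  omega

lemma min_le_levelEnd (k : ℕ) : min n k ≤ levelEnd P σ k := by
  induction k with
  | zero => simp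
  | succ k ih =>
    have h1 := min_le_levelEnd_succ (P := P) (σ := σ) k
    omega

lemma wordLevel_le_iff (x : Fin n) (k : ℕ) :
    wordLevel P σ x ≤ k ↔ (σ.symm x : ℕ) < levelEnd P σ k := by
  constructor
  · intro h
    refine lt_of_lt_of_le (Nat.sInf_mem (s := {k | (σ.symm x : ℕ) < levelEnd P σ k}) ⟨n, ?_⟩)
      (levelEnd_mono h)
    have := min_le_levelEnd (P := P) (σ := σ) n
    have := (σ.symm x).isLt
    simp only [Set.mem_ofPred_eq]
    omega
  · exact fun h => Nat.sInf_le h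

lemma wordLevel_eq_succ_iff (x : Fin n) (k : ℕ) : wordLevel P σ x = k + 1 ↔
    levelEnd P σ k ≤ (σ.symm x : ℕ) ∧ (σ.symm x : ℕ) < levelEnd P σ (k + 1) := by
  rw [← wordLevel_le_iff, ← not_lt, ← wordLevel_le_iff]
  omega

lemma wordLevel_pos (x : Fin n) : 1 ≤ wordLevel P σ x := by
  have := wordLevel_le_iff (P := P) (σ := σ) x 0
  simp only [levelEnd] at this
  omega

lemma isWordLevel_wordLevel (hσ : ∀ i j, StrictRel P i j → σ.symm i < σ.symm j) :
    IsWordLevel P σ (wordLevel P σ) := by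
  have mono : ∀ x y, σ.symm x ≤ σ.symm y → wordLevel P σ x ≤ wordLevel P σ y := fun x y h =>
    (wordLevel_le_iff _ _).2 (lt_of_le_of_lt h ((wordLevel_le_iff y _).1 le_rfl))
  refine ⟨⟨wordLevel_pos, fun p q h => ?_⟩, mono, fun x hx => ?_⟩
  · refine lt_of_le_of_ne (mono p q (hσ p q h).le) fun e => ?_
    obtain ⟨k, hk⟩ := Nat.exists_eq_add_of_le' (wordLevel_pos (P := P) (σ := σ) q)
    exact isAntichain_level k ((wordLevel_eq_succ_iff _ _).1 (e.trans hk))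
      ((wordLevel_eq_succ_iff _ _).1 hk) h.2 h.1
  · obtain ⟨k, hk⟩ := Nat.exists_eq_add_of_le' (wordLevel_pos (P := P) (σ := σ) x)
    cases k with
    | zero => exact Or.inl hk
    | succ m =>
      obtain ⟨h1, h2⟩ := (wordLevel_eq_succ_iff _ _).1 hk
      -- The entry at the cut has level greater than `m + 1`, so it cannot precede the first element
      -- `x` of level `m + 2`.
      have hpos : (σ.symm x : ℕ) = levelEnd P σ (m + 1) := by
        refine le_antisymm (not_lt.1 fun hlt => ?_) h1
        let y := σ ⟨levelEnd P σ (m + 1), hlt.trans (σ.symm x).isLt⟩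
        have hy : (σ.symm y : ℕ) = levelEnd P σ (m + 1) := by simp [y]
        have h3 := hx y (Fin.lt_def.2 (by omega))
        have h4 := (wordLevel_le_iff (P := P) (σ := σ) y (m + 1)).1 (by omega)
        omega
      -- By maximality of the cut, the preceding segment extended by `x` contains a relation. It
      -- must involve `x`, and as its upper element because σ is a linear extension; so `x` is
      -- essential.
      have hnot : ¬ IsAntichain P {y : Fin n | levelEnd P σ m ≤ (σ.symm y : ℕ) ∧
          (σ.symm y : ℕ) < levelEnd P σ (m + 1) + 1} := fun hanti => by
        have := le_csSup (bddAbove_antichainEnds (levelEnd P σ m))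
          ⟨by have := (σ.symm x).isLt; omega, hanti⟩
        exact absurd (show _ ≤ levelEnd P σ (m + 1) from this) (by omega)
      simp only [IsAntichain, Set.Pairwise, not_forall] at hnot
      obtain ⟨a, ha, b, hb, hne, hab⟩ := hnot
      have hab : P a b := by simpa using hab
      have hlt := Fin.lt_def.1 (hσ a b ⟨hab, hne⟩)
      have ha1 := ha.1; have hb1 := hb.1; have hb2 := hb.2
      have haL : (σ.symm a : ℕ) < levelEnd P σ (m + 1) := by omega
      have hbx : b = x := by
        refine σ.symm.injective (Fin.ext ?_)
        by_contra hbx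
        exact isAntichain_level m ⟨ha.1, haL⟩ ⟨hb.1, by omega⟩ hne hab
      subst hbx
      exact Or.inr ⟨a, by rw [hk, (wordLevel_eq_succ_iff a m).2 ⟨ha.1, haL⟩], hab, hne⟩

lemma IsWordLevel.strictRel_lt (h : IsWordLevel P σ ℓ) (i j : Fin n) (hij : StrictRel P i j) :
    σ.symm i < σ.symm j :=
  not_le.1 fun hle => (h.strict i j hij).not_ge (h.mono _ _ hle)

lemma IsWordLevel.exists_end (h : IsWordLevel P σ ℓ) (k : ℕ) :
    ∃ t ≤ n, ∀ x, (σ.symm x : ℕ) < t ↔ ℓ x ≤ k := by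
  classical
  by_cases hex : ∃ t, ∃ ht : t < n, k < ℓ (σ ⟨t, ht⟩)
  · obtain ⟨ht, hk⟩ := Nat.find_spec hex
    refine ⟨Nat.find hex, ht.le, fun x => ⟨fun hx => ?_, fun hx => ?_⟩⟩
    · by_contra hlt
      exact Nat.find_min hex hx ⟨(σ.symm x).isLt, by simpa using hlt⟩
    · by_contra hlt
      have := h.mono (σ ⟨Nat.find hex, ht⟩) x (by rw [Fin.le_def]; simpa using hlt)
      omega
  · refine ⟨n, le_rfl, fun x => ⟨fun _ => ?_, fun _ => (σ.symm x).isLt⟩⟩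
    by_contra hlt
    exact hex ⟨σ.symm x, (σ.symm x).isLt, by simpa using hlt⟩

/-- Strictness makes each level an antichain. A longer segment would contain the first entry of the
next level, which is essential and hence above an element of the segment. -/
lemma IsWordLevel.lt_levelEnd_iff (h : IsWordLevel P σ ℓ) (k : ℕ) :
    ∀ x, (σ.symm x : ℕ) < levelEnd P σ k ↔ ℓ x ≤ k := by
  induction k with
  | zero =>
    intro x
    have := h.pos x
    simp only [levelEnd]
    omega
  | succ k ih =>
    obtain ⟨t, htn, ht⟩ := h.exists_end (k + 1)
    suffices e : levelEnd P σ (k + 1) = t by rwa [e]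
    refine IsGreatest.csSup_eq ⟨⟨htn, ?_⟩, ?_⟩
    · intro x hx y hy _ hP
      have hx1 := (ih x).not.1 (not_lt.2 hx.1)
      have hy1 := (ih y).not.1 (not_lt.2 hy.1)
      have hx2 := (ht x).1 hx.2
      have hy2 := (ht y).1 hy.2
      have := h.strict x y ⟨hP, ‹_›⟩
      omega
    · rintro s ⟨hsn, hs⟩
      by_contra hlt
      push Not at hlt
      let x := σ ⟨t, by omega⟩
      have hx : (σ.symm x : ℕ) = t := by simp [x]
      have hlx : k + 1 < ℓ x := by
        have := (ht x).not.1 (by omega)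
        omega
      have hess : Essential P ℓ x := h.first x fun y hy => by
        have := (ht y).1 (by have := Fin.lt_def.1 hy; omega)
        omega
      rcases hess with h1 | ⟨y, hy, hyx⟩
      · omega
      · have h1 := Fin.lt_def.1 (h.strictRel_lt y x hyx)
        -- As `y` precedes `x`, its level is at most `k + 1`; as `ℓ x > k + 1`, it is exactly `k +
        -- 1`.
        have h2 := (ht y).1 (by omega)
        have h3 := (ih y).not.2 (by omega)
        have h4 := (ih x).not.2 (by omega)
        exact hs (show y ∈ _ from ⟨by omega, by omega⟩) (show x ∈ _ from ⟨by omega, by omega⟩)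
          hyx.2 hyx.1

lemma IsWordLevel.wordLevel_eq (h : IsWordLevel P σ ℓ) : wordLevel P σ = ℓ :=
  funext fun x => eq_of_forall_ge_iff fun k => by rw [wordLevel_le_iff, h.lt_levelEnd_iff]

end Word

end Levels

end PosetCone

namespace PosetCone

/-! ### The fundamental bijection for a fixed injective weight. -/

section CycleForm

variable {n : ℕ} {W : Type*} [LinearOrder W] {w : Fin n → W} {τ σ : Equiv.Perm (Fin n)}

/-! ### The fundamental bijection with respect to an injective weight -/

lemma minimalPeriod_pos_of_perm (τ : Equiv.Perm (Fin n)) (x : Fin n) :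
    0 < Function.minimalPeriod τ x :=
  Function.minimalPeriod_pos_of_mem_periodicPts
    (τ.injective.mem_periodicPts x)

lemma mem_cycleWord {x y : Fin n} : y ∈ cycleWord τ x ↔ τ.SameCycle x y := by
  rw [cycleWord, List.mem_iterate]
  constructor
  · rintro ⟨m, -, rfl⟩
    exact ⟨m, by rw [zpow_natCast, Equiv.Perm.iterate_eq_pow]⟩
  · intro h
    obtain ⟨m, hm⟩ := h.exists_nat_pow_eq
    refine ⟨m % Function.minimalPeriod τ x, Nat.mod_lt _ (minimalPeriod_pos_of_perm τ x), ?_⟩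
    rw [Function.iterate_mod_minimalPeriod_eq, Equiv.Perm.iterate_eq_pow, hm]

lemma nodup_cycleWord (τ : Equiv.Perm (Fin n)) (x : Fin n) : (cycleWord τ x).Nodup := by
  rw [List.nodup_iff_injective_getElem]
  rintro ⟨i, hi⟩ ⟨j, hj⟩ h
  simp only [cycleWord, List.getElem_iterate, List.length_iterate] at h hi hj
  exact Fin.ext (Function.iterate_injOn_Iio_minimalPeriod (Set.mem_Iio.2 hi) (Set.mem_Iio.2 hj) h)

lemma exists_cycleWord_eq_cons (τ : Equiv.Perm (Fin n)) (x : Fin n) :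
    ∃ t, cycleWord τ x = x :: t := by
  obtain ⟨m, hm⟩ := Nat.exists_eq_add_of_le' (minimalPeriod_pos_of_perm τ x)
  exact ⟨_, by rw [cycleWord, hm, List.iterate]⟩

/-- `x` is the element of largest weight in its cycle. -/
def IsHead (w : Fin n → W) (τ : Equiv.Perm (Fin n)) (x : Fin n) : Prop :=
  ∀ y, τ.SameCycle x y → w y ≤ w x

lemma exists_isHead (w : Fin n → W) (τ : Equiv.Perm (Fin n)) (x : Fin n) :
    ∃ h, IsHead w τ h ∧ τ.SameCycle h x := by
  classical
  obtain ⟨h, hh, hmax⟩ := Finset.exists_max_image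
    (Finset.univ.filter fun y => τ.SameCycle x y) w ⟨x, by simp [Equiv.Perm.SameCycle.refl]⟩
  simp only [Finset.mem_filter, Finset.mem_univ, true_and] at hh hmax
  exact ⟨h, fun y hy => hmax y (hh.trans hy), hh.symm⟩

lemma IsHead.eq (hw : Function.Injective w) {x y : Fin n} (hx : IsHead w τ x) (hy : IsHead w τ y)
    (h : τ.SameCycle x y) : x = y :=
  hw (le_antisymm (hy x h.symm) (hx y h))

/-- `xs` lists the elements of largest weight of the cycles of `τ`, by increasing weight. -/
structure IsHeadList (w : Fin n → W) (τ : Equiv.Perm (Fin n)) (xs : List (Fin n)) : Prop where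
  mem_iff : ∀ x, x ∈ xs ↔ IsHead w τ x
  sorted : xs.Pairwise fun x y => w x < w y

lemma exists_isHeadList (hw : Function.Injective w) (τ : Equiv.Perm (Fin n)) :
    ∃ xs, IsHeadList w τ xs := by
  classical
  let s : Finset W := (Finset.univ.filter fun x => IsHead w τ x).image w
  have hs : ∀ a ∈ s.sort (· ≤ ·), ∃ x, w x = a := fun a ha => by
    obtain ⟨x, -, hx⟩ := Finset.mem_image.1 ((Finset.mem_sort _).1 ha)
    exact ⟨x, hx⟩
  choose g hg using hs
  have hg' : ∀ x (h : w x ∈ s.sort (· ≤ ·)), g (w x) h = x := fun x h => hw (hg _ h)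
  refine ⟨(s.sort (· ≤ ·)).pmap g fun _ h => h, fun x => ?_, ?_⟩
  · rw [List.mem_pmap]
    constructor
    · rintro ⟨a, ha, rfl⟩
      obtain ⟨x, hx, rfl⟩ := Finset.mem_image.1 ((Finset.mem_sort _).1 ha)
      rw [hg']
      exact (Finset.mem_filter.1 hx).2
    · intro hx
      have : w x ∈ s.sort (· ≤ ·) := (Finset.mem_sort _).2
        (Finset.mem_image_of_mem _ (Finset.mem_filter.2 ⟨Finset.mem_univ _, hx⟩))
      exact ⟨w x, this, hg' x this⟩
  · rw [List.pairwise_pmap]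
    refine (Finset.sortedLT_sort s).pairwise.imp_of_mem fun {a b} ha hb h _ _ => ?_
    rwa [hg, hg]

lemma IsHeadList.unique {xs ys : List (Fin n)} (hx : IsHeadList w τ xs) (hy : IsHeadList w τ ys) :
    xs = ys := by
  have nodup : ∀ {l : List (Fin n)}, (l.Pairwise fun x y => w x < w y) → l.Nodup := fun h =>
    h.imp fun h e => h.ne (congrArg w e)
  refine List.Perm.eq_of_pairwise (fun a b _ _ h h' => absurd h h'.asymm) hx.sorted hy.sorted ?_
  exact (List.perm_ext_iff_of_nodup (nodup hx.sorted) (nodup hy.sorted)).2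
    fun x => (hx.mem_iff x).trans (hy.mem_iff x).symm

/-- `σ` is the image of `τ` under the fundamental bijection with respect to the weight `w`. -/
def IsCycleForm (w : Fin n → W) (τ σ : Equiv.Perm (Fin n)) : Prop :=
  ∃ xs, IsHeadList w τ xs ∧ List.ofFn σ = eraseParentheses τ xs

/-- All that is needed about positions in the word: heads increase weakly along it, and a head
precedes the rest of its cycle. Stated pairwise, it transfers to positions in `List.ofFn σ`. -/
lemma IsHeadList.pairwise_eraseParentheses (hw : Function.Injective w) {xs : List (Fin n)}
    (h : IsHeadList w τ xs) :
    (eraseParentheses τ xs).Pairwise fun a b => ∀ c d, IsHead w τ c → τ.SameCycle c a →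
      IsHead w τ d → τ.SameCycle d b → w c < w d ∨ c = d ∧ b ≠ d := by
  rw [eraseParentheses, List.pairwise_flatten, List.pairwise_map]
  constructor
  · intro l hl
    obtain ⟨x, hx, rfl⟩ := List.mem_map.1 hl
    obtain ⟨t, ht⟩ := exists_cycleWord_eq_cons τ x
    have hn := nodup_cycleWord τ x
    rw [ht, List.nodup_cons] at hn
    have hall : ∀ a ∈ x :: t, τ.SameCycle x a := fun a ha => mem_cycleWord.1 (ht ▸ ha)
    have key : ∀ a ∈ x :: t, ∀ b ∈ t, ∀ c d, IsHead w τ c → τ.SameCycle c a →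
        IsHead w τ d → τ.SameCycle d b → w c < w d ∨ c = d ∧ b ≠ d := by
      intro a ha b hb c d hc hca hd hdb
      have hxh := (h.mem_iff x).1 hx
      have h1 : c = x := hc.eq hw hxh (hca.trans (hall a ha).symm)
      have h2 : d = x := hd.eq hw hxh (hdb.trans (hall b (List.mem_cons_of_mem _ hb)).symm)
      subst h1 h2
      exact Or.inr ⟨rfl, fun e => hn.1 (e ▸ hb)⟩
    rw [ht, List.pairwise_cons]
    refine ⟨fun b hb => key x List.mem_cons_self b hb, ?_⟩
    exact (List.pairwise_of_forall_mem_list (r := fun a b => ∀ c d, IsHead w τ c →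
      τ.SameCycle c a → IsHead w τ d → τ.SameCycle d b → w c < w d ∨ c = d ∧ b ≠ d)
      fun a ha b hb => key a (List.mem_cons_of_mem _ ha) b hb)
  · refine h.sorted.imp_of_mem fun {x y} hx hy hxy a ha b hb c d hc hca hd hdb => Or.inl ?_
    rwa [hc.eq hw ((h.mem_iff x).1 hx) (hca.trans (mem_cycleWord.1 ha).symm),
      hd.eq hw ((h.mem_iff y).1 hy) (hdb.trans (mem_cycleWord.1 hb).symm)]

lemma IsHeadList.mem_eraseParentheses {xs : List (Fin n)} (h : IsHeadList w τ xs) (y : Fin n) :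
    y ∈ eraseParentheses τ xs := by
  obtain ⟨x, hx, hxy⟩ := exists_isHead w τ y
  exact List.mem_flatten.2 ⟨_, List.mem_map.2 ⟨x, (h.mem_iff x).2 hx, rfl⟩, mem_cycleWord.2 hxy⟩

lemma IsHeadList.nodup_eraseParentheses (hw : Function.Injective w) {xs : List (Fin n)}
    (h : IsHeadList w τ xs) : (eraseParentheses τ xs).Nodup := by
  rw [eraseParentheses, List.nodup_flatten]
  refine ⟨fun l hl => ?_, ?_⟩
  · obtain ⟨x, -, rfl⟩ := List.mem_map.1 hl
    exact nodup_cycleWord τ x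
  · rw [List.pairwise_map]
    refine h.sorted.imp_of_mem fun {x y} hx hy hxy a ha hb => hxy.ne (congrArg w ?_)
    exact ((h.mem_iff x).1 hx).eq hw ((h.mem_iff y).1 hy)
      ((mem_cycleWord.1 ha).trans (mem_cycleWord.1 hb).symm)

lemma exists_perm_ofFn_eq {l : List (Fin n)} (hn : l.Nodup) (hl : ∀ x, x ∈ l) :
    ∃ σ : Equiv.Perm (Fin n), List.ofFn σ = l := by
  let e := hn.getEquivOfForallMemList l hl
  have hlen : l.length = n := by simpa using Fintype.card_congr e
  refine ⟨(finCongr hlen.symm).trans e, ?_⟩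
  apply List.ext_getElem
  · simp [hlen]
  · intro i h1 h2
    simp [e]

lemma exists_isCycleForm (hw : Function.Injective w) (τ : Equiv.Perm (Fin n)) :
    ∃ σ, IsCycleForm w τ σ := by
  obtain ⟨xs, hxs⟩ := exists_isHeadList hw τ
  obtain ⟨σ, hσ⟩ := exists_perm_ofFn_eq (hxs.nodup_eraseParentheses hw) hxs.mem_eraseParentheses
  exact ⟨σ, xs, hxs, hσ⟩

/-- A word splits in at most one way into segments that start with their element of largest
weight, by increasing largest weight. -/
lemma eq_of_flatten_eq {α : Type*} {w : α → W} {L M : List (List α)}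
    (hL : ∀ l ∈ L, ∃ x t, l = x :: t ∧ ∀ a ∈ t, w a ≤ w x)
    (hM : ∀ l ∈ M, ∃ x t, l = x :: t ∧ ∀ a ∈ t, w a ≤ w x)
    (hL' : L.Pairwise fun l m => ∀ x ∈ l.head?, ∀ y ∈ m.head?, w x < w y)
    (hM' : M.Pairwise fun l m => ∀ x ∈ l.head?, ∀ y ∈ m.head?, w x < w y)
    (h : L.flatten = M.flatten) : L = M := by
  induction L generalizing M with
  | nil =>
    cases M with
    | nil => rfl
    | cons m M =>
      obtain ⟨x, t, rfl, -⟩ := hM m List.mem_cons_self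
      simp at h
  | cons l L ih =>
    cases M with
    | nil =>
      obtain ⟨x, t, rfl, -⟩ := hL l List.mem_cons_self
      simp at h
    | cons m M =>
      obtain ⟨x, t, rfl, hxt⟩ := hL l List.mem_cons_self
      obtain ⟨y, s, rfl, hys⟩ := hM m List.mem_cons_self
      -- If one first segment is longer than the other, its excess `u` begins the next segment of
      -- the other splitting. The head of that segment outweighs `x`, while nothing in `u` does; so
      -- `u` is empty.
      have aux : ∀ {x : α} {s u v : List α} {L : List (List α)}
          (_ : ∀ l ∈ L, ∃ x t, l = x :: t ∧ ∀ a ∈ t, w a ≤ w x)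
          (_ : ∀ l ∈ L, ∀ y ∈ l.head?, w x < w y) (_ : ∀ a ∈ s ++ u, w a ≤ w x)
          (_ : L.flatten = u ++ v), u = [] := by
        intro x s u v L h1 h2 h3 h4
        cases u with
        | nil => rfl
        | cons b u =>
          cases L with
          | nil => simp at h4
          | cons l L =>
            obtain ⟨z, t, rfl, -⟩ := h1 l List.mem_cons_self
            simp only [List.flatten_cons, List.cons_append, List.cons.injEq] at h4
            have h5 := h2 _ List.mem_cons_self z rfl
            have h6 := h3 b (by simp)
            rw [← h4.1] at h6
            exact absurd h5 h6.not_gt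
      simp only [List.flatten_cons, List.cons_append, List.cons.injEq] at h
      obtain ⟨rfl, h⟩ := h
      have hst : t = s ∧ L.flatten = M.flatten := by
        rcases List.append_eq_append_iff.1 h with ⟨u, rfl, hu⟩ | ⟨u, rfl, hu⟩
        · have := aux (fun l hl => hL l (List.mem_cons_of_mem _ hl))
            (fun l hl => (List.pairwise_cons.1 hL').1 l hl x rfl) hys hu
          subst this
          simpa using hu
        · have := aux (fun l hl => hM l (List.mem_cons_of_mem _ hl))
            (fun l hl => (List.pairwise_cons.1 hM').1 l hl x rfl) hxt hu
          subst this
          simpa using hu.symm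
      rw [hst.1, ih (fun l hl => hL l (List.mem_cons_of_mem _ hl))
        (fun l hl => hM l (List.mem_cons_of_mem _ hl)) (List.pairwise_cons.1 hL').2
        (List.pairwise_cons.1 hM').2 hst.2]

lemma iterate_eq_of_cycleWord_eq {τ' : Equiv.Perm (Fin n)} {x : Fin n}
    (h : cycleWord τ x = cycleWord τ' x) (k : ℕ) : τ^[k] x = τ'^[k] x := by
  have hp : Function.minimalPeriod τ x = Function.minimalPeriod τ' x := by
    simpa [cycleWord] using congrArg List.length h
  rw [← Function.iterate_mod_minimalPeriod_eq (f := τ),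
    ← Function.iterate_mod_minimalPeriod_eq (f := τ'), ← hp]
  have hk := Nat.mod_lt k (minimalPeriod_pos_of_perm τ x)
  have := List.getElem_of_eq h (i := k % Function.minimalPeriod τ x) (by simpa [cycleWord] using hk)
  simpa [cycleWord] using this

lemma IsHeadList.cycleWords {xs : List (Fin n)} (h : IsHeadList w τ xs) :
    (∀ l ∈ xs.map (cycleWord τ), ∃ x t, l = x :: t ∧ ∀ a ∈ t, w a ≤ w x) ∧
      (xs.map (cycleWord τ)).Pairwise fun l m => ∀ x ∈ l.head?, ∀ y ∈ m.head?, w x < w y := by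
  constructor
  · intro l hl
    obtain ⟨x, hx, rfl⟩ := List.mem_map.1 hl
    obtain ⟨t, ht⟩ := exists_cycleWord_eq_cons τ x
    exact ⟨x, t, ht, fun a ha => (h.mem_iff x).1 hx a
      (mem_cycleWord.1 (ht ▸ List.mem_cons_of_mem _ ha))⟩
  · rw [List.pairwise_map]
    refine h.sorted.imp fun {x y} hxy a ha b hb => ?_
    obtain ⟨t, ht⟩ := exists_cycleWord_eq_cons τ x
    obtain ⟨s, hs⟩ := exists_cycleWord_eq_cons τ y
    rw [ht] at ha
    rw [hs] at hb
    simp only [List.head?_cons, Option.mem_def, Option.some.injEq] at ha hb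
    rwa [← ha, ← hb]

/-- The word splits uniquely into cycle words, and each cycle word determines the permutation on its
orbit. -/
lemma IsCycleForm.injective {τ' : Equiv.Perm (Fin n)} (h : IsCycleForm w τ σ)
    (h' : IsCycleForm w τ' σ) : τ = τ' := by
  obtain ⟨xs, hxs, e⟩ := h
  obtain ⟨ys, hys, e'⟩ := h'
  have hwords : xs.map (cycleWord τ) = ys.map (cycleWord τ') :=
    eq_of_flatten_eq hxs.cycleWords.1 hys.cycleWords.1 hxs.cycleWords.2 hys.cycleWords.2
      (e.symm.trans e')
  ext1 y
  obtain ⟨x, hx, hxy⟩ := exists_isHead w τ y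
  have hmem : cycleWord τ x ∈ ys.map (cycleWord τ') :=
    hwords ▸ List.mem_map.2 ⟨x, (hxs.mem_iff x).2 hx, rfl⟩
  obtain ⟨z, -, hz⟩ := List.mem_map.1 hmem
  obtain ⟨t, ht⟩ := exists_cycleWord_eq_cons τ x
  obtain ⟨s, hs⟩ := exists_cycleWord_eq_cons τ' z
  have hzx : z = x := by
    rw [ht, hs] at hz
    exact (List.cons.inj hz).1
  subst hzx
  obtain ⟨k, hk⟩ := hxy.exists_nat_pow_eq
  have it := iterate_eq_of_cycleWord_eq hz.symm
  have h1 := it k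
  have h2 := it (k + 1)
  rw [Function.iterate_succ_apply', Function.iterate_succ_apply', ← h1] at h2
  rwa [Equiv.Perm.iterate_eq_pow, hk] at h2

lemma IsCycleForm.unique {σ' : Equiv.Perm (Fin n)} (h : IsCycleForm w τ σ)
    (h' : IsCycleForm w τ σ') : σ = σ' := by
  obtain ⟨xs, hxs, e⟩ := h
  obtain ⟨ys, hys, e'⟩ := h'
  rw [hxs.unique hys] at e
  exact DFunLike.coe_injective (List.ofFn_injective (e.trans e'.symm))

/-- No inverse is constructed: an injective self-map of a finite set is surjective. -/
lemma exists_isCycleForm_of_word (hw : Function.Injective w) (σ : Equiv.Perm (Fin n)) :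
    ∃ τ, IsCycleForm w τ σ := by
  choose φ hφ using exists_isCycleForm hw
  have hinj : Function.Injective φ := fun τ τ' h => (hφ τ).injective (h ▸ hφ τ')
  obtain ⟨τ, rfl⟩ := Finite.surjective_of_injective hinj σ
  exact ⟨τ, hφ τ⟩

lemma IsCycleForm.head_lt_or (hw : Function.Injective w) (h : IsCycleForm w τ σ)
    {a b c d : Fin n} (hab : σ.symm a < σ.symm b) (hc : IsHead w τ c) (hca : τ.SameCycle c a)
    (hd : IsHead w τ d) (hdb : τ.SameCycle d b) : w c < w d ∨ c = d ∧ b ≠ d := by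
  obtain ⟨xs, hxs, e⟩ := h
  have := hxs.pairwise_eraseParentheses hw
  rw [← e, List.pairwise_ofFn] at this
  simpa using this hab c d (by simpa using hc) (by simpa using hca) hd (by simpa using hdb)

lemma IsCycleForm.head_le (hw : Function.Injective w) (h : IsCycleForm w τ σ)
    {a b c d : Fin n} (hab : σ.symm a ≤ σ.symm b) (hc : IsHead w τ c) (hca : τ.SameCycle c a)
    (hd : IsHead w τ d) (hdb : τ.SameCycle d b) : w c ≤ w d := by
  rcases hab.lt_or_eq with hlt | e
  · rcases h.head_lt_or hw hlt hc hca hd hdb with h1 | ⟨rfl, -⟩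
    exacts [h1.le, le_rfl]
  · obtain rfl := σ.symm.injective e
    rw [hc.eq hw hd (hca.trans hdb.symm)]

lemma IsCycleForm.head_first (hw : Function.Injective w) (h : IsCycleForm w τ σ)
    {x c : Fin n} (hc : IsHead w τ c) (hcx : τ.SameCycle c x) : σ.symm c ≤ σ.symm x := by
  by_contra hlt
  rcases h.head_lt_or hw (not_le.1 hlt) hc hcx hc (.refl _ _) with h1 | ⟨-, h1⟩
  exacts [h1.false, h1 rfl]

lemma IsCycleForm.isHead_iff (hw : Function.Injective w) (h : IsCycleForm w τ σ) (x : Fin n) :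
    IsHead w τ x ↔ ∀ y, σ.symm y < σ.symm x → w y < w x := by
  constructor
  · intro hx y hy
    obtain ⟨c, hc, hcy⟩ := exists_isHead w τ y
    refine lt_of_le_of_ne ((hc y hcy).trans (h.head_le hw hy.le hc hcy hx (.refl _ _))) fun e => ?_
    rw [hw e] at hy
    exact hy.false
  · intro hx
    obtain ⟨c, hc, hcx⟩ := exists_isHead w τ x
    rcases (h.head_first hw hc hcx).lt_or_eq with hlt | e
    · exact absurd (hx c hlt) (hc x hcx).not_gt
    · rwa [← σ.symm.injective e]

lemma card_isHead (hw : Function.Injective w) (τ : Equiv.Perm (Fin n)) :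
    Set.ncard {x | IsHead w τ x} = cyc τ := by
  rw [cyc, ← Nat.card_coe_set_eq]
  refine Nat.card_eq_of_bijective
    (fun x : {x | IsHead w τ x} => Quotient.mk (cyclePartition τ) x.1) ⟨?_, ?_⟩
  · intro x y h
    exact Subtype.ext (IsHead.eq hw x.2 y.2 (Quotient.exact h))
  · intro B
    induction B using Quotient.inductionOn with | _ b => ?_
    obtain ⟨c, hc, hcb⟩ := exists_isHead w τ b
    exact ⟨⟨c, hc⟩, Quotient.sound hcb⟩

end CycleForm

end PosetCone

namespace PosetCone

/-! ### Transport of levels between τ and σ, and the bijection Φ. -/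

section Bijection

variable {n : ℕ} {P : Fin n → Fin n → Prop} {ℓ : Fin n → ℕ} {τ σ : Equiv.Perm (Fin n)}

/-! ### The weight attached to a level function -/

open scoped Classical in
/-- Elements are compared by level; within a level, the essential elements come last; then the
integers are compared. -/
noncomputable def weight (P : Fin n → Fin n → Prop) (ℓ : Fin n → ℕ) (x : Fin n) :
    ℕ ×ₗ Bool ×ₗ Fin n :=
  toLex (ℓ x, toLex (decide (Essential P ℓ x), x))

lemma weight_injective (P : Fin n → Fin n → Prop) (ℓ : Fin n → ℕ) :
    Function.Injective (weight P ℓ) := fun x y h => by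
  simp only [weight, EmbeddingLike.apply_eq_iff_eq, Prod.mk.injEq] at h
  exact h.2.2

lemma weight_lt_iff {x y : Fin n} : weight P ℓ x < weight P ℓ y ↔ ℓ x < ℓ y ∨ ℓ x = ℓ y ∧
    (¬ Essential P ℓ x ∧ Essential P ℓ y ∨ (Essential P ℓ x ↔ Essential P ℓ y) ∧ x < y) := by
  classical
  simp only [weight, Prod.Lex.toLex_lt_toLex, Bool.lt_iff, decide_eq_true_eq, decide_eq_false_iff_not,
    decide_eq_decide]

lemma level_le_of_weight_le {x y : Fin n} (h : weight P ℓ x ≤ weight P ℓ y) : ℓ x ≤ ℓ y := by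
  by_contra hlt
  exact h.not_gt (weight_lt_iff.2 (Or.inl (not_le.1 hlt)))

lemma weight_le_iff_of_essential {x y : Fin n} (hx : Essential P ℓ x) (hy : Essential P ℓ y)
    (h : ℓ x = ℓ y) : weight P ℓ x ≤ weight P ℓ y ↔ x ≤ y := by
  rw [← not_lt, weight_lt_iff]
  simp [hx, hy, h]

lemma essential_of_weight_le {x y : Fin n} (hx : Essential P ℓ x) (h : ℓ x = ℓ y)
    (hle : weight P ℓ x ≤ weight P ℓ y) : Essential P ℓ y := by
  by_contra hy
  exact hle.not_gt (weight_lt_iff.2 (Or.inr ⟨h.symm, Or.inl ⟨hy, hx⟩⟩))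

/-! ### Levels under the fundamental bijection -/

lemma IsBlockLevel.essential_of_isHead (h : IsBlockLevel P (cyclePartition τ) ℓ) {x : Fin n}
    (hx : IsHead (weight P ℓ) τ x) : Essential P ℓ x := by
  obtain ⟨y, hxy, hy⟩ := h.exists_essential x
  exact essential_of_weight_le hy (h.const _ _ hxy).symm (hx y hxy)

/-- Heads increase in weight, hence in level, and levels are constant on cycles. The first entry of
a level is a head, since the head of its cycle has the same level and does not come later. -/
lemma IsBlockLevel.isWordLevel (h : IsBlockLevel P (cyclePartition τ) ℓ)
    (hσ : IsCycleForm (weight P ℓ) τ σ) : IsWordLevel P σ ℓ := by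
  have hw := weight_injective P ℓ
  refine ⟨h.toIsLevelFunction, fun x y hxy => ?_, fun x hx => ?_⟩
  · obtain ⟨c, hc, hcx⟩ := exists_isHead (weight P ℓ) τ x
    obtain ⟨d, hd, hdy⟩ := exists_isHead (weight P ℓ) τ y
    rw [← h.const c x hcx, ← h.const d y hdy]
    exact level_le_of_weight_le (hσ.head_le hw hxy hc hcx hd hdy)
  · obtain ⟨c, hc, hcx⟩ := exists_isHead (weight P ℓ) τ x
    rcases (hσ.head_first hw hc hcx).lt_or_eq with hlt | e
    · exact absurd (h.const c x hcx) (hx c hlt).ne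
    · rw [← σ.symm.injective e]
      exact h.essential_of_isHead hc

/-- The first entry of the level of `x` is essential, and a record is at least as heavy as that
entry. -/
lemma IsWordLevel.essential_of_record (h : IsWordLevel P σ ℓ) {x : Fin n}
    (hx : ∀ y, σ.symm y < σ.symm x → weight P ℓ y < weight P ℓ x) : Essential P ℓ x := by
  classical
  obtain ⟨f, hf, hmin⟩ := Finset.exists_min_image (Finset.univ.filter fun y => ℓ y = ℓ x) σ.symm
    ⟨x, by simp⟩
  simp only [Finset.mem_filter, Finset.mem_univ, true_and] at hf hmin
  have hfe : Essential P ℓ f := h.first f fun y hy =>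
    lt_of_le_of_ne (h.mono y f hy.le) fun e => hy.not_ge (hmin y (e.trans hf))
  rcases (hmin x rfl).lt_or_eq with hlt | e
  · exact essential_of_weight_le hfe hf (hx f hlt).le
  · rwa [← σ.symm.injective e]

lemma IsWordLevel.isBlockLevel (h : IsWordLevel P σ ℓ) (hσ : IsCycleForm (weight P ℓ) τ σ) :
    IsBlockLevel P (cyclePartition τ) ℓ := by
  have hw := weight_injective P ℓ
  -- The head comes first in its cycle, so its level is at most that of `x`; it is heaviest, so its
  -- level is at least that of `x`.
  have head : ∀ c x, IsHead (weight P ℓ) τ c → τ.SameCycle c x → ℓ c = ℓ x := fun c x hc hcx =>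
    le_antisymm (h.mono _ _ (hσ.head_first hw hc hcx)) (level_le_of_weight_le (hc x hcx))
  refine ⟨h.toIsLevelFunction, fun x y hxy => ?_, fun x => ?_⟩
  · obtain ⟨c, hc, hcx⟩ := exists_isHead (weight P ℓ) τ x
    rw [← head c x hc hcx, head c y hc (hcx.trans hxy)]
  · obtain ⟨c, hc, hcx⟩ := exists_isHead (weight P ℓ) τ x
    exact ⟨c, hcx.symm, h.essential_of_record ((hσ.isHead_iff hw c).1 hc)⟩

/-- Earlier entries of lower level, and inessential ones of the same level, are automatically
lighter than an essential `x`; only the essential entries of its level compete. -/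
lemma IsWordLevel.isPLRMax_iff (h : IsWordLevel P σ ℓ) (x : Fin n) :
    IsPLRMax P σ x ↔ ∀ y, σ.symm y < σ.symm x → weight P ℓ y < weight P ℓ x := by
  rw [IsPLRMax, h.wordLevel_eq]
  constructor
  · rintro ⟨hx, hmax⟩ y hy
    rw [weight_lt_iff]
    rcases (h.mono y x hy.le).lt_or_eq with hlt | e
    · exact Or.inl hlt
    · refine Or.inr ⟨e, ?_⟩
      by_cases hye : Essential P ℓ y
      · refine Or.inr ⟨by simp [hx, hye], lt_of_le_of_ne (hmax y hye e hy.le) ?_⟩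
        rintro rfl
        exact hy.false
      · exact Or.inl ⟨hye, hx⟩
  · intro hx
    have hxe := h.essential_of_record hx
    refine ⟨hxe, fun y hye e hy => ?_⟩
    rcases hy.lt_or_eq with hlt | e'
    · exact (weight_le_iff_of_essential hye hxe e).1 (hx y hlt).le
    · exact (σ.symm.injective e').le

lemma IsWordLevel.cyc_eq (h : IsWordLevel P σ ℓ) (hσ : IsCycleForm (weight P ℓ) τ σ) :
    cyc τ = PLRmax P σ := by
  rw [← card_isHead (weight_injective P ℓ), PLRmax]
  congr 1
  ext x
  exact (hσ.isHead_iff (weight_injective P ℓ) x).trans (h.isPLRMax_iff x).symm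

/-! ### Standard forms -/

lemma IsBlockLevel.isStandardForm_iff (h : IsBlockLevel P (cyclePartition τ) ℓ)
    (xs : List (Fin n)) : IsStandardForm P τ xs ↔ IsHeadList (weight P ℓ) τ xs := by
  have hw := weight_injective P ℓ
  have hlev := permLevel_eq h
  constructor
  · rintro ⟨hcyc, hess, hmax, hsort⟩
    rw [hlev] at hess hmax hsort
    have hhead : ∀ x ∈ xs, IsHead (weight P ℓ) τ x := fun x hx y hxy => by
      by_cases hy : Essential P ℓ y
      · exact (weight_le_iff_of_essential hy (hess x hx) (h.const _ _ hxy).symm).2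
          (hmax x hx y hxy hy)
      · exact (weight_lt_iff.2 (Or.inr ⟨(h.const _ _ hxy).symm, Or.inl ⟨hy, hess x hx⟩⟩)).le
    refine ⟨fun x => ⟨hhead x, fun hx => ?_⟩, ?_⟩
    · obtain ⟨y, ⟨hy, hyx⟩, -⟩ := hcyc x
      rwa [← (hhead y hy).eq hw hx hyx]
    · refine hsort.imp_of_mem fun {x y} hx hy hxy => ?_
      rw [weight_lt_iff]
      refine hxy.imp_right fun hxy => ⟨hxy.1, Or.inr ⟨?_, hxy.2⟩⟩
      simp [hess x hx, hess y hy]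
  · rintro ⟨hmem, hsort⟩
    have hess : ∀ x ∈ xs, Essential P ℓ x := fun x hx =>
      h.essential_of_isHead ((hmem x).1 hx)
    refine ⟨fun y => ?_, by rwa [hlev], ?_, ?_⟩
    · obtain ⟨c, hc, hcy⟩ := exists_isHead (weight P ℓ) τ y
      exact ⟨c, ⟨(hmem c).2 hc, hcy⟩, fun d hd =>
        ((hmem d).1 hd.1).eq hw hc (hd.2.trans hcy.symm)⟩
    · rw [hlev]
      exact fun x hx y hxy hy => (weight_le_iff_of_essential hy (hess x hx)
        (h.const _ _ hxy).symm).1 ((hmem x).1 hx y hxy)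
    · rw [hlev]
      refine hsort.imp_of_mem fun {x y} hx hy hxy => ?_
      have := weight_lt_iff.1 hxy
      simpa [hess x hx, hess y hy] using this

lemma mem_transversePerms : τ ∈ transversePerms P ↔ IsTransverse P (cyclePartition τ) := by
  simp [transversePerms]

lemma mem_linearExtensions :
    σ ∈ linearExtensions P ↔ ∀ i j, StrictRel P i j → σ.symm i < σ.symm j := by
  simp [linearExtensions]

lemma existsUnique_isStandardForm (hτ : τ ∈ transversePerms P) :
    ∃! xs, IsStandardForm P τ xs := by
  have h := isBlockLevel_permLevel (mem_transversePerms.1 hτ)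
  simp only [h.isStandardForm_iff]
  obtain ⟨xs, hxs⟩ := exists_isHeadList (weight_injective P (permLevel P τ)) τ
  exact ⟨xs, hxs, fun ys hys => hys.unique hxs⟩

lemma exists_equiv_isCycleForm (P : Fin n → Fin n → Prop) :
    ∃ Φ : transversePerms P ≃ linearExtensions P, ∀ τ : transversePerms P,
      IsCycleForm (weight P (permLevel P τ.1)) τ.1 (Φ τ).1 := by
  choose φ hφ using fun τ : Equiv.Perm (Fin n) =>
    exists_isCycleForm (weight_injective P (permLevel P τ)) τ
  have hlevel : ∀ τ ∈ transversePerms P, IsWordLevel P (φ τ) (permLevel P τ) := fun τ hτ =>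
    (isBlockLevel_permLevel (mem_transversePerms.1 hτ)).isWordLevel (hφ τ)
  let Φ : transversePerms P → linearExtensions P := fun τ =>
    ⟨φ τ.1, mem_linearExtensions.2 (hlevel τ.1 τ.2).strictRel_lt⟩
  have hbij : Function.Bijective Φ := by
    constructor
    · rintro ⟨τ, hτ⟩ ⟨τ', hτ'⟩ h
      have h : φ τ = φ τ' := congrArg Subtype.val h
      -- Both level functions are the `wordLevel` of the common image, so the two weights agree.
      have e : permLevel P τ = permLevel P τ' := by
        rw [← (hlevel τ hτ).wordLevel_eq, ← (hlevel τ' hτ').wordLevel_eq, h]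
      have h1 := hφ τ
      rw [h, e] at h1
      exact Subtype.ext (h1.injective (hφ τ'))
    · rintro ⟨σ, hσ⟩
      have hword := isWordLevel_wordLevel (mem_linearExtensions.1 hσ)
      -- The weight is built from the levels of σ; these turn out to be the levels of τ as well.
      obtain ⟨τ, hτ⟩ := exists_isCycleForm_of_word (weight_injective P (wordLevel P σ)) σ
      have hblock := hword.isBlockLevel hτ
      refine ⟨⟨τ, mem_transversePerms.2 hblock.isTransverse⟩, Subtype.ext ?_⟩
      have h1 := hφ τ
      rw [permLevel_eq hblock] at h1
      exact h1.unique hτ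
  exact ⟨Equiv.ofBijective Φ hbij, fun τ => hφ τ.1⟩

/-! ### Antichains -/

lemma isBlockLevel_one (hP : ∀ i j, ¬ StrictRel P i j) (π : Setoid (Fin n)) :
    IsBlockLevel P π fun _ => 1 :=
  ⟨⟨fun _ => le_rfl, fun p q h => absurd h (hP p q)⟩, fun _ _ _ => rfl,
    fun x => ⟨x, π.refl x, Or.inl rfl⟩⟩

lemma isWordLevel_one (hP : ∀ i j, ¬ StrictRel P i j) (σ : Equiv.Perm (Fin n)) :
    IsWordLevel P σ fun _ => 1 :=
  ⟨⟨fun _ => le_rfl, fun p q h => absurd h (hP p q)⟩, fun _ _ _ => le_rfl,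
    fun _ _ => Or.inl rfl⟩

lemma PLRmax_eq_LRmax (hP : ∀ i j, ¬ StrictRel P i j) (σ : Equiv.Perm (Fin n)) :
    PLRmax P σ = LRmax σ := by
  simp [PLRmax, LRmax, IsPLRMax, (isWordLevel_one hP σ).wordLevel_eq, Essential]

lemma isStandardForm_sort_of_antichain (hP : ∀ i j, ¬ StrictRel P i j) (τ : Equiv.Perm (Fin n))
    [DecidablePred fun x : Fin n => ∀ y, τ.SameCycle x y → y ≤ x] :
    IsStandardForm P τ
      ((Finset.univ.filter fun x : Fin n => ∀ y, τ.SameCycle x y → y ≤ x).sort (· ≤ ·)) := by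
  have hess : ∀ x, Essential P (fun _ => 1) x := fun x => Or.inl rfl
  refine ((isBlockLevel_one hP _).isStandardForm_iff _).2 ⟨fun x => ?_, ?_⟩
  · simp only [Finset.mem_sort, Finset.mem_filter, Finset.mem_univ, true_and, IsHead,
      weight_le_iff_of_essential (hess _) (hess _) rfl]
  · refine (Finset.sortedLT_sort _).pairwise.imp fun {x y} h => weight_lt_iff.2 ?_
    exact Or.inr ⟨rfl, Or.inr ⟨by simp [hess], h⟩⟩

end Bijection

end PosetCone

namespace PosetCone

/-! ### Whitney numbers of the cone as counts of transverse permutations. -/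

section Poincare

variable {n : ℕ} {P : Fin n → Fin n → Prop} {τ : Equiv.Perm (Fin n)}

/-! ### Fixed spaces of permutations and the Möbius function -/

/-- The vectors that are constant on the cycles of `τ`. -/
def fixedSpace (τ : Equiv.Perm (Fin n)) : Submodule ℝ (Fin n → ℝ) where
  carrier := {x | ∀ i j, τ.SameCycle i j → x i = x j}
  add_mem' {x y} hx hy i j h := by simp only [Pi.add_apply, hx i j h, hy i j h]
  zero_mem' _ _ _ := rfl
  smul_mem' c x hx i j h := by simp only [Pi.smul_apply, hx i j h]

lemma mem_fixedSpace {x : Fin n → ℝ} :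
    x ∈ fixedSpace τ ↔ ∀ i j, τ.SameCycle i j → x i = x j := Iff.rfl

lemma mem_fixedSpace_iff_apply {x : Fin n → ℝ} : x ∈ fixedSpace τ ↔ ∀ i, x (τ i) = x i := by
  refine ⟨fun h i => (h i (τ i) (Equiv.Perm.sameCycle_apply_right.2 (.refl _ _))).symm,
    fun h i j hij => ?_⟩
  obtain ⟨k, rfl⟩ := hij.exists_nat_pow_eq
  induction k with
  | zero => rfl
  | succ k ih =>
    rw [pow_succ', Equiv.Perm.mul_apply, h]
    exact ih ⟨k, by simp⟩

lemma mem_braidHyperplane {i j : Fin n} {x : Fin n → ℝ} :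
    x ∈ braidHyperplane i j ↔ x i = x j := Iff.rfl

lemma fixedSpace_mem_intersections (τ : Equiv.Perm (Fin n)) :
    OrderDual.toDual (fixedSpace τ) ∈ intersections (braidArrangement n) := by
  classical
  refine Finset.mem_image.2 ⟨(Finset.univ.filter fun p : Fin n × Fin n =>
    p.1 < p.2 ∧ τ.SameCycle p.1 p.2).image fun p => braidHyperplane p.1 p.2, ?_, ?_⟩
  · rw [Finset.mem_powerset]
    refine Finset.image_subset_image fun p hp => ?_
    simp only [Finset.mem_filter, Finset.mem_univ, true_and] at hp ⊢
    exact hp.1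
  · congr 1
    ext x
    simp only [Finset.inf_image, Submodule.mem_finsetInf, Finset.mem_filter, Finset.mem_univ,
      true_and, Function.comp, id, mem_braidHyperplane, mem_fixedSpace]
    constructor
    · intro h i j hij
      rcases lt_trichotomy i j with hlt | rfl | hlt
      · exact h (i, j) ⟨hlt, hij⟩
      · rfl
      · exact (h (j, i) ⟨hlt, hij.symm⟩).symm
    · exact fun h p hp => h _ _ hp.2

/-- The fixed space of `τ` as an element of the intersection poset. -/
def fixedFlat (τ : Equiv.Perm (Fin n)) : IntersectionPoset (braidArrangement n) :=
  ⟨OrderDual.toDual (fixedSpace τ), fixedSpace_mem_intersections τ⟩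

lemma fixedFlat_le_iff {X : IntersectionPoset (braidArrangement n)} :
    fixedFlat τ ≤ X ↔ X.subspace ≤ fixedSpace τ := Iff.rfl

lemma whole_le (X : IntersectionPoset (braidArrangement n)) :
    IntersectionPoset.whole (braidArrangement n) ≤ X :=
  show X.subspace ≤ ⊤ from le_top

lemma eq_one_of_fixedSpace_eq_top (h : fixedSpace τ = ⊤) : τ = 1 := by
  ext1 i
  have : (fun j : Fin n => (j : ℝ)) ∈ fixedSpace τ := h ▸ Submodule.mem_top
  have := mem_fixedSpace_iff_apply.1 this i
  exact Fin.ext (by exact_mod_cast this)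

lemma exists_le_braidHyperplane {X : IntersectionPoset (braidArrangement n)}
    (hX : X.subspace ≠ ⊤) : ∃ i j, i ≠ j ∧ X.subspace ≤ braidHyperplane i j := by
  classical
  obtain ⟨S, hS, hSX⟩ := Finset.mem_image.1 X.2
  have hXS : X.subspace = S.inf id := by rw [IntersectionPoset.subspace, ← hSX]; rfl
  rcases S.eq_empty_or_nonempty with rfl | ⟨H, hH⟩
  · exact absurd (by simpa using hXS) hX
  · obtain ⟨p, hp, rfl⟩ := Finset.mem_image.1 (Finset.mem_powerset.1 hS hH)
    exact ⟨p.1, p.2, (Finset.mem_filter.1 hp).2.ne, hXS ▸ Finset.inf_le (f := id) hH⟩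

open scoped Classical in
/-- The signs of the permutations that fix `X` cancel, unless `X` is the whole space. -/
lemma sum_sign_fixing (X : IntersectionPoset (braidArrangement n)) :
    ∑ τ : Equiv.Perm (Fin n) with X.subspace ≤ fixedSpace τ, (Equiv.Perm.sign τ : ℤ) =
      if IntersectionPoset.whole (braidArrangement n) = X then 1 else 0 := by
  split_ifs with h
  · subst h
    have : (Finset.univ.filter fun τ : Equiv.Perm (Fin n) =>
        (IntersectionPoset.whole (braidArrangement n)).subspace ≤ fixedSpace τ) = {1} := by
      ext τ
      simp only [Finset.mem_filter, Finset.mem_univ, true_and, Finset.mem_singleton]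
      constructor
      · exact fun h => eq_one_of_fixedSpace_eq_top (top_le_iff.1 h)
      · rintro rfl x -
        exact mem_fixedSpace_iff_apply.2 fun i => rfl
    rw [this]
    simp
  · obtain ⟨i, j, hij, hX⟩ := exists_le_braidHyperplane (X := X)
      fun e => h (Subtype.ext (congrArg OrderDual.toDual e).symm)
    have hswap : ∀ x ∈ X.subspace, ∀ k, x (Equiv.swap i j k) = x k := fun x hx k => by
      have := mem_braidHyperplane.1 (hX hx)
      rw [Equiv.swap_apply_def]
      split_ifs with h1 h2
      · rw [h1, this]
      · rw [h2, this]
      · rfl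
    -- Left multiplication by the transposition reverses signs. It preserves the condition because
    -- `x i = x j` on `X`.
    refine Finset.sum_involution (fun τ _ => Equiv.swap i j * τ) (fun τ _ => ?_) (fun τ _ _ => ?_)
      (fun τ hτ => ?_) (fun τ _ => ?_)
    · simp [Equiv.Perm.sign_swap hij]
    · intro e
      exact hij (Equiv.swap_eq_one_iff.1 (mul_eq_right.1 e))
    · simp only [Finset.mem_filter, Finset.mem_univ, true_and] at hτ ⊢
      intro x hx
      refine mem_fixedSpace_iff_apply.2 fun k => ?_
      rw [Equiv.Perm.mul_apply, hswap x hx, mem_fixedSpace_iff_apply.1 (hτ hx)]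
    · simp

open scoped Classical in
-- Summed over the interval from `V` to `X`, both sides give 1 if `X = V` and 0 otherwise; strong
-- induction removes all terms except that of `X`.
lemma moebius_eq_sum_sign (X : IntersectionPoset (braidArrangement n)) :
    moebius (braidArrangement n) X =
      ∑ τ : Equiv.Perm (Fin n) with fixedFlat τ = X, (Equiv.Perm.sign τ : ℤ) := by
  induction X using WellFoundedLT.induction with | _ X ih => ?_
  have h1 := IncidenceAlgebra.sum_Icc_mu_right (𝕜 := ℤ)
    (IntersectionPoset.whole (braidArrangement n)) X
  rw [← sum_sign_fixing X] at h1
  have h2 : ∑ τ : Equiv.Perm (Fin n) with X.subspace ≤ fixedSpace τ, (Equiv.Perm.sign τ : ℤ) =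
      ∑ Y ∈ Finset.Icc (IntersectionPoset.whole (braidArrangement n)) X,
        ∑ τ : Equiv.Perm (Fin n) with fixedFlat τ = Y, (Equiv.Perm.sign τ : ℤ) := by
    rw [← Finset.sum_fiberwise_of_maps_to (t := Finset.Icc
      (IntersectionPoset.whole (braidArrangement n)) X) (g := fixedFlat) fun τ hτ =>
      Finset.mem_Icc.2 ⟨whole_le _, fixedFlat_le_iff.2 (Finset.mem_filter.1 hτ).2⟩]
    refine Finset.sum_congr rfl fun Y hY => Finset.sum_congr ?_ fun _ _ => rfl
    ext τ
    simp only [Finset.mem_filter, Finset.mem_univ, true_and, and_iff_right_iff_imp]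
    rintro rfl
    exact (Finset.mem_Icc.1 hY).2
  rw [h2, ← Finset.Ico_insert_right (whole_le X), Finset.sum_insert Finset.right_notMem_Ico,
    Finset.sum_insert Finset.right_notMem_Ico] at h1
  have h3 : ∑ Y ∈ Finset.Ico (IntersectionPoset.whole (braidArrangement n)) X,
        moebius (braidArrangement n) Y =
      ∑ Y ∈ Finset.Ico (IntersectionPoset.whole (braidArrangement n)) X,
        ∑ τ : Equiv.Perm (Fin n) with fixedFlat τ = Y, (Equiv.Perm.sign τ : ℤ) :=
    Finset.sum_congr rfl fun Y hY => ih Y (Finset.mem_Ico.1 hY).2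
  rw [← h3] at h1
  exact add_right_cancel h1

/-- Tested on the indicator function of the cycle of `i`. The fixed space thus recovers the cycle
partition. -/
lemma sameCycle_iff_fixedSpace {i j : Fin n} :
    τ.SameCycle i j ↔ ∀ x ∈ fixedSpace τ, x i = x j := by
  classical
  refine ⟨fun h x hx => hx i j h, fun h => ?_⟩
  have := h (fun k => if τ.SameCycle i k then 1 else 0) fun a b hab => by
    have : τ.SameCycle i a ↔ τ.SameCycle i b := ⟨fun h => h.trans hab, fun h => h.trans hab.symm⟩
    simp only [this]
  by_contra hn
  simp [hn, Equiv.Perm.SameCycle.refl] at this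

lemma sameCycle_congr_of_fixedSpace_eq {τ' : Equiv.Perm (Fin n)}
    (h : fixedSpace τ = fixedSpace τ') (i j : Fin n) : τ.SameCycle i j ↔ τ'.SameCycle i j := by
  rw [sameCycle_iff_fixedSpace, sameCycle_iff_fixedSpace, h]

open scoped Classical in
/-- The supports of the nontrivial cycles of `τ`, described through its orbits. -/
lemma image_support_cycleFactorsFinset (τ : Equiv.Perm (Fin n)) :
    τ.cycleFactorsFinset.image Equiv.Perm.support =
      ((Finset.univ.filter fun x => ∃ y, y ≠ x ∧ τ.SameCycle x y).image fun x =>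
        Finset.univ.filter fun y => τ.SameCycle x y) := by
  have hsupp : ∀ x ∈ τ.support, (τ.cycleOf x).support =
      Finset.univ.filter fun y => τ.SameCycle x y := fun x hx => by
    ext y
    simp only [Finset.mem_filter, Finset.mem_univ, true_and, Equiv.Perm.mem_support_cycleOf_iff]
    exact ⟨fun h => h.1, fun h => ⟨h, hx⟩⟩
  ext s
  simp only [Finset.mem_image, Finset.mem_filter, Finset.mem_univ, true_and]
  constructor
  · rintro ⟨c, hc, rfl⟩
    obtain ⟨x, hx⟩ := (Equiv.Perm.mem_cycleFactorsFinset_iff.1 hc).1.nonempty_support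
    have hcx := Equiv.Perm.cycle_is_cycleOf hx hc
    have hxτ : x ∈ τ.support := Equiv.Perm.mem_cycleFactorsFinset_support_le hc hx
    refine ⟨x, ⟨τ x, Equiv.Perm.mem_support.1 hxτ,
      Equiv.Perm.sameCycle_apply_right.2 (.refl _ _)⟩, ?_⟩
    rw [hcx, hsupp x hxτ]
  · rintro ⟨x, ⟨y, hyx, hxy⟩, rfl⟩
    have hxτ : x ∈ τ.support := by
      rw [Equiv.Perm.mem_support]
      intro hfix
      exact hyx (hxy.eq_of_left hfix).symm
    exact ⟨τ.cycleOf x, Equiv.Perm.cycleOf_mem_cycleFactorsFinset_iff.2 hxτ, hsupp x hxτ⟩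

/-- Distinct cycles have disjoint nonempty supports, so passing to the set of supports loses no
multiplicity; the cycle type, and with it the sign, depends only on the cycle partition. -/
lemma cycleType_eq_map_card [DecidableEq (Fin n)] (τ : Equiv.Perm (Fin n)) : τ.cycleType =
    (τ.cycleFactorsFinset.image Equiv.Perm.support).val.map Finset.card := by
  rw [Equiv.Perm.cycleType_def, Finset.image_val_of_injOn, Multiset.map_map]
  intro c hc d hd h
  by_contra hne
  have hdisj := (Equiv.Perm.cycleFactorsFinset_pairwise_disjoint τ hc hd hne).disjoint_support
  obtain ⟨x, hx⟩ := (Equiv.Perm.mem_cycleFactorsFinset_iff.1 hc).1.nonempty_support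
  exact Finset.disjoint_left.1 hdisj hx (h ▸ hx)

lemma sign_eq_of_fixedSpace_eq {τ' : Equiv.Perm (Fin n)} (h : fixedSpace τ = fixedSpace τ') :
    Equiv.Perm.sign τ = Equiv.Perm.sign τ' := by
  have : τ.cycleType = τ'.cycleType := by
    rw [cycleType_eq_map_card, cycleType_eq_map_card]
    congr 2
    convert (image_support_cycleFactorsFinset τ).trans ?_
    convert (image_support_cycleFactorsFinset τ').symm using 1
    simp only [sameCycle_congr_of_fixedSpace_eq h]
  rw [Equiv.Perm.sign_of_cycleType, Equiv.Perm.sign_of_cycleType, this]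

open scoped Classical in
lemma natAbs_moebius (X : IntersectionPoset (braidArrangement n)) :
    (moebius (braidArrangement n) X).natAbs =
      (Finset.univ.filter fun τ : Equiv.Perm (Fin n) => fixedFlat τ = X).card := by
  rw [moebius_eq_sum_sign]
  by_cases hex : ∃ τ₀ : Equiv.Perm (Fin n), fixedFlat τ₀ = X
  · obtain ⟨τ₀, rfl⟩ := hex
    rw [Finset.sum_congr rfl fun τ hτ => by
      rw [sign_eq_of_fixedSpace_eq (τ' := τ₀)
        (congrArg IntersectionPoset.subspace (Finset.mem_filter.1 hτ).2)]]
    rw [Finset.sum_const, nsmul_eq_mul, Int.natAbs_mul, Int.natAbs_natCast,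
      Int.units_natAbs, mul_one]
  -- With no such permutation both sides vanish, so it need not be shown that every `X` is a fixed
  -- space.
  · rw [Finset.filter_false_of_mem fun τ _ h => hex ⟨τ, h⟩]
    simp

/-! ### Codimension of fixed spaces, and fixed spaces that meet the cone -/

/-- The vectors constant on cycles are the functions on the set of cycles. -/
noncomputable def fixedSpaceEquiv (τ : Equiv.Perm (Fin n)) :
    fixedSpace τ ≃ₗ[ℝ] (Quotient (cyclePartition τ) → ℝ) where
  toFun x := Quotient.lift x.1 x.2
  invFun f := ⟨fun i => f (Quotient.mk _ i), fun _ _ h => congrArg f (Quotient.sound h)⟩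
  map_add' _ _ := funext fun B => Quotient.inductionOn B fun _ => rfl
  map_smul' _ _ := funext fun B => Quotient.inductionOn B fun _ => rfl
  left_inv _ := rfl
  right_inv _ := funext fun B => Quotient.inductionOn B fun _ => rfl

lemma finrank_quotient_fixedSpace (τ : Equiv.Perm (Fin n)) :
    Module.finrank ℝ ((Fin n → ℝ) ⧸ fixedSpace τ) = n - cyc τ := by
  classical
  rw [Submodule.finrank_quotient, (fixedSpaceEquiv τ).finrank_eq, Module.finrank_fintype_fun_eq_card,
    Module.finrank_fintype_fun_eq_card, Fintype.card_fin, cyc, Nat.card_eq_fintype_card]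

/-- A point of the intersection is a real function constant on cycles and strictly increasing along
`P`, which forces transversality; conversely, the level function is itself such a point. -/
lemma fixedSpace_inter_posetCone_nonempty_iff :
    ((fixedSpace τ : Set (Fin n → ℝ)) ∩ posetCone P).Nonempty ↔
      IsTransverse P (cyclePartition τ) := by
  constructor
  · rintro ⟨x, hx, hxK⟩
    exact isTransverse_of_strictMono hxK hx
  · intro h
    obtain ⟨ℓ, hℓ⟩ := h.exists_isBlockLevel
    exact ⟨fun i => ℓ i, fun i j hij => congrArg Nat.cast (hℓ.const i j hij),
      fun i j hij => Nat.cast_lt.2 (hℓ.strict i j hij)⟩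

open scoped Classical in
lemma whitney_eq_card (P : Fin n → Fin n → Prop) (k : ℕ) :
    whitney (braidArrangement n) (posetCone P) k =
      ((transversePerms P).filter fun τ => n - cyc τ = k).card := by
  rw [whitney, Finset.sum_congr rfl fun X _ => natAbs_moebius X]
  rw [Finset.card_eq_sum_card_fiberwise (f := fixedFlat) (t := Finset.univ.filter
    fun X : IntersectionPoset (braidArrangement n) =>
      (((X.subspace : Set (Fin n → ℝ)) ∩ posetCone P).Nonempty ∧
        Module.finrank ℝ ((Fin n → ℝ) ⧸ X.subspace) = k))]
  · refine Finset.sum_congr rfl fun X hX => congrArg Finset.card ?_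
    ext τ
    simp only [Finset.mem_filter, Finset.mem_univ, true_and, mem_transversePerms,
      iff_and_self] at hX ⊢
    rintro rfl
    exact ⟨fixedSpace_inter_posetCone_nonempty_iff.1 hX.1,
      (finrank_quotient_fixedSpace τ).symm.trans hX.2⟩
  · intro τ hτ
    simp only [Finset.coe_filter, Set.mem_ofPred_eq, mem_transversePerms] at hτ
    simp only [Finset.coe_filter, Set.mem_ofPred_eq, Finset.mem_univ, true_and]
    exact ⟨fixedSpace_inter_posetCone_nonempty_iff.2 hτ.1,
      (finrank_quotient_fixedSpace τ).trans hτ.2⟩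

lemma Poin_eq_sum_transversePerms (P : Fin n → Fin n → Prop) :
    Poin P = ∑ τ ∈ transversePerms P, (Polynomial.X : Polynomial ℕ) ^ (n - cyc τ) := by
  classical
  rw [Poin, poincare, Module.finrank_fintype_fun_eq_card, Fintype.card_fin,
    ← Finset.sum_fiberwise_of_maps_to (t := Finset.range (n + 1)) (g := fun τ => n - cyc τ)
      fun τ _ => Finset.mem_range.2 (by omega)]
  refine Finset.sum_congr rfl fun k _ => ?_
  rw [Finset.sum_congr rfl fun τ hτ => by rw [(Finset.mem_filter.1 hτ).2], Finset.sum_const,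
    whitney_eq_card, nsmul_eq_mul]
  simp

end Poincare

end PosetCone

theorem theorem1p2 (n : ℕ) (P : Fin n → Fin n → Prop) [IsPartialOrder (Fin n) P] :
    (∀ τ ∈ PosetCone.transversePerms P, ∃! xs, PosetCone.IsStandardForm P τ xs) ∧
    (∃ Φ : PosetCone.transversePerms P ≃ PosetCone.linearExtensions P,
      (∀ (τ : PosetCone.transversePerms P) (xs : List (Fin n)),
        PosetCone.IsStandardForm P τ.1 xs →
          List.ofFn (Φ τ).1 = PosetCone.eraseParentheses τ.1 xs) ∧
      (∀ τ : PosetCone.transversePerms P, PosetCone.cyc τ.1 = PosetCone.PLRmax P (Φ τ).1) ∧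
      ((∀ i j, ¬ PosetCone.StrictRel P i j) →
        (∀ τ : Equiv.Perm (Fin n), ∃ h : τ ∈ PosetCone.transversePerms P,
          List.ofFn (Φ ⟨τ, h⟩).1 = PosetCone.fundamentalWord τ) ∧
        ∀ σ : Equiv.Perm (Fin n), σ ∈ PosetCone.linearExtensions P ∧
          PosetCone.PLRmax P σ = PosetCone.LRmax σ)) ∧
    PosetCone.Poin P =
      ∑ σ ∈ PosetCone.linearExtensions P,
        (Polynomial.X : Polynomial ℕ) ^ (n - PosetCone.PLRmax P σ) := by
  obtain ⟨Φ, hΦ⟩ := PosetCone.exists_equiv_isCycleForm P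
  have hlevel : ∀ τ : PosetCone.transversePerms P,
      PosetCone.IsBlockLevel P (PosetCone.cyclePartition τ.1) (PosetCone.permLevel P τ.1) :=
    fun τ => PosetCone.isBlockLevel_permLevel (PosetCone.mem_transversePerms.1 τ.2)
  have hword : ∀ (τ : PosetCone.transversePerms P) (xs : List (Fin n)),
      PosetCone.IsStandardForm P τ.1 xs →
        List.ofFn (Φ τ).1 = PosetCone.eraseParentheses τ.1 xs := fun τ xs hxs => by
    obtain ⟨ys, hys, e⟩ := hΦ τ
    rw [e, hys.unique (((hlevel τ).isStandardForm_iff xs).1 hxs)]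
  have hcyc : ∀ τ : PosetCone.transversePerms P,
      PosetCone.cyc τ.1 = PosetCone.PLRmax P (Φ τ).1 := fun τ =>
    ((hlevel τ).isWordLevel (hΦ τ)).cyc_eq (hΦ τ)
  refine ⟨fun τ hτ => PosetCone.existsUnique_isStandardForm hτ,
    ⟨Φ, hword, hcyc, fun hP => ⟨fun τ => ?_, fun σ => ⟨?_, PosetCone.PLRmax_eq_LRmax hP σ⟩⟩⟩, ?_⟩
  · refine ⟨PosetCone.mem_transversePerms.2 (PosetCone.isBlockLevel_one hP _).isTransverse, ?_⟩
    exact hword ⟨τ, _⟩ _ (PosetCone.isStandardForm_sort_of_antichain hP τ)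
  · exact PosetCone.mem_linearExtensions.2 fun i j h => absurd h (hP i j)
  · rw [PosetCone.Poin_eq_sum_transversePerms, ← Finset.sum_coe_sort,
      ← Finset.sum_coe_sort (PosetCone.linearExtensions P)]
    exact Fintype.sum_equiv Φ _ _ fun τ => by rw [hcyc]
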